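/- **Setting.** Let $W$ be a smooth manifold of dimension $2n$ with a symplectic form $\omega$ (a smooth, closed, non-degenerate $2$-form). Let $J^1_n(W)$ be the manifold of $1$-jets of $n$-dimensional submanifolds of $W$, i.e. the bundle over $W$ whose points are the pairs $(a,L)$ with $a\in W$ and $L\subset T_aW$ an $n$-dimensional subspace; let $\pi(a,L)=a$. The Cartan distribution of $J^1_n(W)$ at $q=(a,L)$ is $(d\pi_q)^{-1}(L)\subset T_qJ^1_n(W)$. The first order PDE of Lagrangian submanifolds is $$\mathcal L_1=\{(a,L)\in J^1_n(W) : \omega_a|_{L}=0\}.$$ A *bar singular $p$-simplex* of $\mathcal L_1$ is a map $f:\Delta^p\to\mathcal L_1$ on the standard simplex $\Delta^p\subset\mathbb R^{p+1}$ that extends to a $C^\infty$ map from an open neighbourhood of $\Delta^p$ in $\mathbb R^{p+1}$ to $\mathcal L_1$ and whose tangent map sends the vectors tangent to $\Delta^p$ into the Cartan distribution. Let $G$ be an abelian group. The finite formal combinations of bar singular $p$-simplices with coefficients in $G$ form a group $\bar C_p(\mathcal L_1;G)$, and with the alternating sum of the faces as boundary operator $\bar\partial$ they form the bar singular chain complex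 of $\mathcal L_1$. Let $\bar B_p$ and $\bar Z_p$ be its groups of boundaries and of cycles in degree $p$ (with $\bar Z_0=\bar C_0$), and let $\bar H_p(\mathcal L_1;G)$ be its homology. Put - $\bar{Bor}_p(\mathcal L_1;G)=\bar C_p/\bar B_p$ (chains $a,b$ are identified when $a-b=\bar\partial c$ for some chain $c$), - $\bar{Cyc}_p(\mathcal L_1;G)=\bar C_p/\bar Z_p$ (chains $a,b$ are identified when $\bar\partial(a-b)=0$), - ${}^G\Omega^{\mathcal L_1}_{p,s}$: the group of cycles in $\bar Z_p$, two cycles $a,b$ being identified when $a-b=\bar\partial c$ for some chain $c$. This is the $G$-singular bordism group of $p$-dimensional compact submanifolds of $W$ bording by means of Lagrangian submanifolds. If $G$ is a module over a ring $R$, all these groups are $R$-modules; every abelian group is such a module for $R=\mathbb Z$, and a ring $G$ is one for $R=G$. **Theorem ($G$-singular Lagrangian bordism groups).** Let $R$ be a ring, $G$ an $R$-module and $p\ge 0$. 1. There is an isomorphism of $R$-modules ${}^G\Omega^{\mathcal L_1}_{p,s}\cong\bar H_p(\mathcal L_1;G)$ that sends the bordism class of a cycle to its homology class. 2. If ${}^G\Omega^{\mathcal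 L_1}_{p,s}=0$, then the canonical map $[c]\mapsto[c]$ is an isomorphism of $R$-modules $\bar{Bor}_p(\mathcal L_1;G)\cong\bar{Cyc}_p(\mathcal L_1;G)$. 3. If $\bar{Cyc}_p(\mathcal L_1;G)$ is a free $R$-module, then the exact sequence $0\to{}^G\Omega^{\mathcal L_1}_{p,s}\to\bar{Bor}_p(\mathcal L_1;G)\to\bar{Cyc}_p(\mathcal L_1;G)\to0$ splits: there is an isomorphism of $R$-modules $$\bar{Bor}_p(\mathcal L_1;G)\cong{}^G\Omega^{\mathcal L_1}_{p,s}\oplus\bar{Cyc}_p(\mathcal L_1;G)$$ that carries the class of a cycle $z$ to $([z],0)$ and whose second component is the canonical projection. -/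

import Mathlib

open scoped Manifold ContDiff
open Set

noncomputable section

/-- The model space `ℝ²ⁿ` of a `2n`-dimensional manifold. -/
abbrev ModelSpace (n : ℕ) : Type := EuclideanSpace ℝ (Fin (2 * n))

/-- The Euclidean space `ℝⁿ`. -/
abbrev CoordSpace (n : ℕ) : Type := EuclideanSpace ℝ (Fin n)

/-- The set `J¹ₙ(W)` of `1`-jets of `n`-dimensional submanifolds of the `2n`-manifold `W`: the
`1`-jet at `a` of a submanifold through `a` is its tangent space there, so a jet is a point of `W`
with an `n`-dimensional subspace of the tangent space at that point. -/
@[ext]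
structure JetOne (n : ℕ) (W : Type*) [TopologicalSpace W] [ChartedSpace (ModelSpace n) W] where
  pt : W
  plane : Submodule ℝ (TangentSpace (𝓡 (2 * n)) pt)
  finrank_plane : Module.finrank ℝ plane = n

namespace JetOne

section LinearAlgebra

variable {n : ℕ}

theorem map_graph_eq_graph_iff (M : (CoordSpace n × CoordSpace n) ≃L[ℝ] (CoordSpace n × CoordSpace n))
    (A A' : CoordSpace n →L[ℝ] CoordSpace n) :
    (A : CoordSpace n →ₗ[ℝ] CoordSpace n).graph.map (M : (CoordSpace n × CoordSpace n) →ₗ[ℝ] _) =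
        (A' : CoordSpace n →ₗ[ℝ] CoordSpace n).graph ↔
      IsUnit ((ContinuousLinearMap.fst ℝ _ _).comp
          ((M : (CoordSpace n × CoordSpace n) →L[ℝ] CoordSpace n × CoordSpace n).comp ((ContinuousLinearMap.id ℝ _).prod A))) ∧
        A' = ((ContinuousLinearMap.snd ℝ _ _).comp
          ((M : (CoordSpace n × CoordSpace n) →L[ℝ] CoordSpace n × CoordSpace n).comp ((ContinuousLinearMap.id ℝ _).prod A))).comp
            (Ring.inverse ((ContinuousLinearMap.fst ℝ _ _).comp
              ((M : (CoordSpace n × CoordSpace n) →L[ℝ] CoordSpace n × CoordSpace n).comp ((ContinuousLinearMap.id ℝ _).prod A)))) := by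
  set P : CoordSpace n →L[ℝ] CoordSpace n := (ContinuousLinearMap.fst ℝ _ _).comp
          ((M : (CoordSpace n × CoordSpace n) →L[ℝ] CoordSpace n × CoordSpace n).comp ((ContinuousLinearMap.id ℝ _).prod A)) with hP
  set Q : CoordSpace n →L[ℝ] CoordSpace n := (ContinuousLinearMap.snd ℝ _ _).comp
          ((M : (CoordSpace n × CoordSpace n) →L[ℝ] CoordSpace n × CoordSpace n).comp ((ContinuousLinearMap.id ℝ _).prod A)) with hQ
  have hM : ∀ x, M (x, A x) = (P x, Q x) := fun x => rfl
  constructor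
  · intro h
    have hQP : ∀ x, Q x = A' (P x) := by
      intro x
      have : M (x, A x) ∈ (A' : CoordSpace n →ₗ[ℝ] CoordSpace n).graph := by
        rw [← h]
        exact ⟨(x, A x), by simp [LinearMap.mem_graph_iff], rfl⟩
      rw [hM] at this
      simpa [LinearMap.mem_graph_iff] using this
    have hinj : Function.Injective P := by
      rw [injective_iff_map_eq_zero]
      intro x hx
      have h0 : M (x, A x) = 0 := by rw [hM, hQP, hx]; simp
      have := M.map_eq_zero_iff.1 h0
      exact (Prod.ext_iff.1 this).1
    have hu : IsUnit P := by
      let e := LinearEquiv.toContinuousLinearEquiv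
        (LinearEquiv.ofInjectiveEndo (P : CoordSpace n →ₗ[ℝ] CoordSpace n) hinj)
      exact ⟨ContinuousLinearEquiv.toUnit e, by ext x; rfl⟩
    refine ⟨hu, ?_⟩
    have : Q = A' * P := by ext1 x; exact hQP x
    change A' = Q * Ring.inverse P
    rw [this, Ring.mul_inverse_cancel_right _ _ hu]
  · rintro ⟨hu, rfl⟩
    have hQ' : (Q * Ring.inverse P) * P = Q := Ring.inverse_mul_cancel_right _ _ hu
    have hQP : ∀ x, Q x = (Q.comp (Ring.inverse P)) (P x) := fun x =>
      (congrArg (fun T : CoordSpace n →L[ℝ] CoordSpace n => T x) hQ').symm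
    have hPi : ∀ y, P (Ring.inverse P y) = y := fun y =>
      congrArg (fun T : CoordSpace n →L[ℝ] CoordSpace n => T y) (Ring.mul_inverse_cancel P hu)
    ext ⟨y, z⟩
    simp only [Submodule.mem_map, LinearMap.mem_graph_iff, Prod.exists]
    constructor
    · rintro ⟨x, w, rfl, h⟩
      have h' : (P x, Q x) = (y, z) := h
      obtain ⟨rfl, rfl⟩ := Prod.ext_iff.1 h'
      exact hQP x
    · intro h
      refine ⟨Ring.inverse P y, A (Ring.inverse P y), rfl, ?_⟩
      change (P _, Q _) = (y, z)
      exact Prod.ext (hPi y) h.symm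

theorem exists_split (L : Submodule ℝ (ModelSpace n)) (hL : Module.finrank ℝ L = n) :
    ∃ e : ModelSpace n ≃L[ℝ] CoordSpace n × CoordSpace n,
      L.map (e : ModelSpace n →ₗ[ℝ] CoordSpace n × CoordSpace n) =
        ((0 : CoordSpace n →L[ℝ] CoordSpace n) : CoordSpace n →ₗ[ℝ] CoordSpace n).graph := by
  obtain ⟨C, hC⟩ := Submodule.exists_isCompl L
  have hsum := Submodule.finrank_add_eq_of_isCompl hC
  have hE : Module.finrank ℝ (ModelSpace n) = 2 * n := by simp
  have hCn : Module.finrank ℝ C = n := by omega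
  let eL : L ≃ₗ[ℝ] CoordSpace n := LinearEquiv.ofFinrankEq _ _ (by simp [hL])
  let eC : C ≃ₗ[ℝ] CoordSpace n := LinearEquiv.ofFinrankEq _ _ (by simp [hCn])
  let e := (Submodule.prodEquivOfIsCompl L C hC).symm.trans (eL.prodCongr eC)
  refine ⟨e.toContinuousLinearEquiv, ?_⟩
  ext ⟨y, z⟩
  simp only [Submodule.mem_map, LinearMap.mem_graph_iff]
  constructor
  · rintro ⟨x, hx, h⟩
    have h' : e x = (y, z) := h
    have : (Submodule.prodEquivOfIsCompl L C hC).symm x = ((⟨x, hx⟩ : L), 0) :=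
      Submodule.prodEquivOfIsCompl_symm_apply_left L C hC (⟨x, hx⟩ : L)
    simp only [e, LinearEquiv.trans_apply, this] at h'
    have := (Prod.ext_iff.1 h').2
    simpa using this.symm
  · intro h
    refine ⟨eL.symm y, (eL.symm y).2, ?_⟩
    change e _ = _
    simp only [e, LinearEquiv.trans_apply, Submodule.prodEquivOfIsCompl_symm_apply_left]
    have : z = 0 := by simpa using h
    simp [this]

end LinearAlgebra

variable {n : ℕ} {W : Type*} [TopologicalSpace W] [ChartedSpace (ModelSpace n) W]
  [IsManifold (𝓡 (2 * n)) ∞ W]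

/-- The differential at `b` of the chart of `W` around `a`. Its domain of definition is the domain
of the chart. -/
def chartDerivOfMem (a b : W) (h : b ∈ (chartAt (ModelSpace n) a).source) :
    TangentSpace (𝓡 (2 * n)) b ≃L[ℝ] ModelSpace n :=
  ContinuousLinearEquiv.equivOfInverse
    (tangentCoordChange (𝓡 (2 * n)) b a b) (tangentCoordChange (𝓡 (2 * n)) a b b)
    (fun v => by
      have hb : b ∈ (extChartAt (𝓡 (2 * n)) b).source := mem_extChartAt_source b
      have ha : b ∈ (extChartAt (𝓡 (2 * n)) a).source := by simpa using h
      exact (tangentCoordChange_comp ⟨⟨hb, ha⟩, hb⟩).trans (tangentCoordChange_self hb))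
    (fun v => by
      have hb : b ∈ (extChartAt (𝓡 (2 * n)) b).source := mem_extChartAt_source b
      have ha : b ∈ (extChartAt (𝓡 (2 * n)) a).source := by simpa using h
      exact (tangentCoordChange_comp ⟨⟨ha, hb⟩, ha⟩).trans (tangentCoordChange_self ha))

open Classical in
/-- The differential at `b` of the chart of `W` around `a`, extended by the differential of the
chart around `b` itself when `b` is outside the domain of the chart around `a`. -/
def chartDeriv (a b : W) : TangentSpace (𝓡 (2 * n)) b ≃L[ℝ] ModelSpace n :=
  if h : b ∈ (chartAt (ModelSpace n) a).source then chartDerivOfMem a b h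
  else chartDerivOfMem b b (mem_chart_source _ b)

theorem chartDeriv_of_mem {a b : W} (h : b ∈ (chartAt (ModelSpace n) a).source) :
    chartDeriv a b = chartDerivOfMem a b h := dif_pos h

theorem chartDeriv_chartDeriv_symm {a a' b : W} (h : b ∈ (chartAt (ModelSpace n) a).source)
    (h' : b ∈ (chartAt (ModelSpace n) a').source) (v : ModelSpace n) :
    chartDeriv a' b ((chartDeriv a b).symm v) = tangentCoordChange (𝓡 (2 * n)) a a' b v := by
  have hb : b ∈ (extChartAt (𝓡 (2 * n)) b).source := mem_extChartAt_source b
  have ha : b ∈ (extChartAt (𝓡 (2 * n)) a).source := by simpa using h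
  have ha' : b ∈ (extChartAt (𝓡 (2 * n)) a').source := by simpa using h'
  rw [chartDeriv_of_mem h', chartDeriv_of_mem h]
  exact tangentCoordChange_comp ⟨⟨ha, hb⟩, ha'⟩

/-- The plane of a jet, read in the chart of `W` around `a` and in a splitting of `ℝ²ⁿ`. -/
def planeIn (a : W) (e : ModelSpace n ≃L[ℝ] CoordSpace n × CoordSpace n) (q : JetOne n W) :
    Submodule ℝ (CoordSpace n × CoordSpace n) :=
  q.plane.map (((chartDeriv a q.pt).trans e : _ ≃L[ℝ] CoordSpace n × CoordSpace n) :
    TangentSpace (𝓡 (2 * n)) q.pt →ₗ[ℝ] CoordSpace n × CoordSpace n)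

/-- The jet with base point `b` whose plane is the graph of `A` in the given coordinates. -/
def ofGraph (a : W) (e : ModelSpace n ≃L[ℝ] CoordSpace n × CoordSpace n) (b : W)
    (A : CoordSpace n →L[ℝ] CoordSpace n) : JetOne n W where
  pt := b
  plane := (A : CoordSpace n →ₗ[ℝ] CoordSpace n).graph.map
    (((chartDeriv a b).trans e).symm.toLinearEquiv : _ →ₗ[ℝ] TangentSpace (𝓡 (2 * n)) b)
  finrank_plane := by
    rw [LinearEquiv.finrank_map_eq, LinearMap.graph_eq_range_prod,
      LinearMap.finrank_range_of_inj]
    · simp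
    · intro x y h
      exact (Prod.ext_iff.1 h).1

theorem planeIn_ofGraph (a a' : W) (e e' : ModelSpace n ≃L[ℝ] CoordSpace n × CoordSpace n) (b : W)
    (A : CoordSpace n →L[ℝ] CoordSpace n) :
    planeIn a' e' (ofGraph a e b A) = (A : CoordSpace n →ₗ[ℝ] CoordSpace n).graph.map
      (((((chartDeriv a b).trans e).symm.trans ((chartDeriv a' b).trans e')) :
        _ ≃L[ℝ] CoordSpace n × CoordSpace n) :
          (CoordSpace n × CoordSpace n) →ₗ[ℝ] CoordSpace n × CoordSpace n) := by
  rw [planeIn, ofGraph, ← Submodule.map_comp]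
  rfl

theorem planeIn_ofGraph_self (a : W) (e : ModelSpace n ≃L[ℝ] CoordSpace n × CoordSpace n) (b : W)
    (A : CoordSpace n →L[ℝ] CoordSpace n) :
    planeIn a e (ofGraph a e b A) = (A : CoordSpace n →ₗ[ℝ] CoordSpace n).graph := by
  rw [planeIn_ofGraph, ContinuousLinearEquiv.symm_trans_self]
  exact Submodule.map_id _

theorem ofGraph_planeIn (a : W) (e : ModelSpace n ≃L[ℝ] CoordSpace n × CoordSpace n)
    (q : JetOne n W) (A : CoordSpace n →L[ℝ] CoordSpace n)
    (h : planeIn a e q = (A : CoordSpace n →ₗ[ℝ] CoordSpace n).graph) :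
    ofGraph a e q.pt A = q := by
  have : (ofGraph a e q.pt A).plane = q.plane := by
    change Submodule.map _ (A : CoordSpace n →ₗ[ℝ] CoordSpace n).graph = _
    rw [← h, planeIn, ← Submodule.map_comp]
    convert Submodule.map_id _
    ext v
    exact ((chartDeriv a q.pt).trans e).symm_apply_apply v
  exact JetOne.ext rfl this

theorem graph_injective {A A' : CoordSpace n →L[ℝ] CoordSpace n}
    (h : (A : CoordSpace n →ₗ[ℝ] CoordSpace n).graph = (A' : CoordSpace n →ₗ[ℝ] CoordSpace n).graph) :
    A = A' := by
  ext1 x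
  have : (x, A x) ∈ (A' : CoordSpace n →ₗ[ℝ] CoordSpace n).graph := by
    rw [← h]; simp [LinearMap.mem_graph_iff]
  simpa [LinearMap.mem_graph_iff] using this

open Classical in
/-- The slope of the plane of a jet: the linear map whose graph it is in the given coordinates. -/
def slope (a : W) (e : ModelSpace n ≃L[ℝ] CoordSpace n × CoordSpace n) (q : JetOne n W) :
    CoordSpace n →L[ℝ] CoordSpace n :=
  if h : ∃ A : CoordSpace n →L[ℝ] CoordSpace n,
    planeIn a e q = (A : CoordSpace n →ₗ[ℝ] CoordSpace n).graph then h.choose else 0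

theorem slope_eq {a : W} {e : ModelSpace n ≃L[ℝ] CoordSpace n × CoordSpace n} {q : JetOne n W}
    {A : CoordSpace n →L[ℝ] CoordSpace n}
    (h : planeIn a e q = (A : CoordSpace n →ₗ[ℝ] CoordSpace n).graph) : slope a e q = A := by
  have h' : ∃ A : CoordSpace n →L[ℝ] CoordSpace n,
    planeIn a e q = (A : CoordSpace n →ₗ[ℝ] CoordSpace n).graph := ⟨A, h⟩
  rw [slope, dif_pos h']
  exact graph_injective (h'.choose_spec.symm.trans h)

/-- The standard coordinates `(xᵅ, yʲ, yʲ_α)` on `J¹ₙ(W)`: coordinates of the base point, and the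
slope of the plane with respect to a splitting `ℝ²ⁿ = ℝⁿ × ℝⁿ` of the coordinates. -/
def jetChart (a : W) (e : ModelSpace n ≃L[ℝ] CoordSpace n × CoordSpace n) :
    PartialEquiv (JetOne n W) (ModelSpace n × (CoordSpace n →L[ℝ] CoordSpace n)) where
  toFun q := (chartAt (ModelSpace n) a q.pt, slope a e q)
  invFun z := ofGraph a e ((chartAt (ModelSpace n) a).symm z.1) z.2
  source := {q | q.pt ∈ (chartAt (ModelSpace n) a).source ∧
    ∃ A : CoordSpace n →L[ℝ] CoordSpace n,
      planeIn a e q = (A : CoordSpace n →ₗ[ℝ] CoordSpace n).graph}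
  target := {z | z.1 ∈ (chartAt (ModelSpace n) a).target}
  map_source' q hq := (chartAt (ModelSpace n) a).map_source hq.1
  map_target' z hz := ⟨(chartAt (ModelSpace n) a).map_target hz, z.2, planeIn_ofGraph_self _ _ _ _⟩
  left_inv' q hq := by
    obtain ⟨h, A, hA⟩ := hq
    simp only [(chartAt (ModelSpace n) a).left_inv h, slope_eq hA]
    exact ofGraph_planeIn a e q A hA
  right_inv' z hz := by
    refine Prod.ext ((chartAt (ModelSpace n) a).right_inv hz) ?_
    exact slope_eq (planeIn_ofGraph_self _ _ _ _)

/-- The derivative of a change of charts of `W`, read in two splittings. -/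
def transMat (a a' : W) (e e' : ModelSpace n ≃L[ℝ] CoordSpace n × CoordSpace n) (y : ModelSpace n) :
    (CoordSpace n × CoordSpace n) →L[ℝ] CoordSpace n × CoordSpace n :=
  (e' : ModelSpace n →L[ℝ] CoordSpace n × CoordSpace n).comp
    ((fderiv ℝ (chartAt (ModelSpace n) a' ∘ (chartAt (ModelSpace n) a).symm) y).comp
      (e.symm : (CoordSpace n × CoordSpace n) →L[ℝ] ModelSpace n))

theorem transMat_eq {a a' : W} (e e' : ModelSpace n ≃L[ℝ] CoordSpace n × CoordSpace n)
    {y : ModelSpace n}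
    (hy : y ∈ ((chartAt (ModelSpace n) a).symm.trans (chartAt (ModelSpace n) a')).source) :
    transMat a a' e e' y = ((((chartDeriv a ((chartAt (ModelSpace n) a).symm y)).trans e).symm.trans
      ((chartDeriv a' ((chartAt (ModelSpace n) a).symm y)).trans e') :
        _ ≃L[ℝ] CoordSpace n × CoordSpace n) :
          (CoordSpace n × CoordSpace n) →L[ℝ] CoordSpace n × CoordSpace n) := by
  rw [OpenPartialHomeomorph.trans_source] at hy
  obtain ⟨h1, h2⟩ := hy
  have h1' : y ∈ (chartAt (ModelSpace n) a).target := h1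
  have h := chartDeriv_chartDeriv_symm ((chartAt (ModelSpace n) a).map_target h1')
    (a' := a') h2
  refine ContinuousLinearMap.ext fun v => ?_
  change e' _ = e' (chartDeriv a' _ ((chartDeriv a _).symm (e.symm v)))
  rw [h, tangentCoordChange_def]
  simp [(chartAt (ModelSpace n) a).right_inv h1', fderivWithin_univ]

theorem contDiffOn_transMat (a a' : W) (e e' : ModelSpace n ≃L[ℝ] CoordSpace n × CoordSpace n) :
    ContDiffOn ℝ ∞ (transMat a a' e e')
      ((chartAt (ModelSpace n) a).symm.trans (chartAt (ModelSpace n) a')).source := by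
  have : ContDiffOn ℝ ∞ (fderiv ℝ (chartAt (ModelSpace n) a' ∘ (chartAt (ModelSpace n) a).symm))
      ((chartAt (ModelSpace n) a).symm.trans (chartAt (ModelSpace n) a')).source := by
    have : IsManifold (𝓡 (2 * n)) (∞ + 1) W := ‹IsManifold (𝓡 (2 * n)) ∞ W›
    have := contDiffOn_fderiv_coord_change (n := ∞) (I := 𝓡 (2 * n))
      (achart (ModelSpace n) a) (achart (ModelSpace n) a')
    simpa [fderivWithin_univ] using! this
  unfold transMat
  exact contDiffOn_const.clm_comp (this.clm_comp contDiffOn_const)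

theorem contDiffOn_chart_trans (a a' : W) :
    ContDiffOn ℝ ∞ (chartAt (ModelSpace n) a' ∘ (chartAt (ModelSpace n) a).symm)
      ((chartAt (ModelSpace n) a).symm.trans (chartAt (ModelSpace n) a')).source := by
  have := contDiffOn_ext_coord_change (I := 𝓡 (2 * n)) (n := ∞) a' a
  simpa using! this

/-- The first block of the transformed graph. -/
def blockP (a a' : W) (e e' : ModelSpace n ≃L[ℝ] CoordSpace n × CoordSpace n)
    (z : ModelSpace n × (CoordSpace n →L[ℝ] CoordSpace n)) : CoordSpace n →L[ℝ] CoordSpace n :=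
  (ContinuousLinearMap.fst ℝ _ _).comp
    ((transMat a a' e e' z.1).comp ((ContinuousLinearMap.id ℝ _).prod z.2))

/-- The second block of the transformed graph. -/
def blockQ (a a' : W) (e e' : ModelSpace n ≃L[ℝ] CoordSpace n × CoordSpace n)
    (z : ModelSpace n × (CoordSpace n →L[ℝ] CoordSpace n)) : CoordSpace n →L[ℝ] CoordSpace n :=
  (ContinuousLinearMap.snd ℝ _ _).comp
    ((transMat a a' e e' z.1).comp ((ContinuousLinearMap.id ℝ _).prod z.2))

theorem jetChart_trans_source (a a' : W)
    (e e' : ModelSpace n ≃L[ℝ] CoordSpace n × CoordSpace n) :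
    ((jetChart a e).symm.trans (jetChart a' e')).source =
      {z | z.1 ∈ ((chartAt (ModelSpace n) a).symm.trans (chartAt (ModelSpace n) a')).source ∧
        IsUnit (blockP a a' e e' z)} := by
  ext ⟨y, A⟩
  have key : ∀ hy : y ∈ ((chartAt (ModelSpace n) a).symm.trans (chartAt (ModelSpace n) a')).source,
      (∃ A', planeIn a' e' (ofGraph a e ((chartAt (ModelSpace n) a).symm y) A) =
        ((A' : CoordSpace n →L[ℝ] CoordSpace n) : CoordSpace n →ₗ[ℝ] CoordSpace n).graph) ↔
        IsUnit (blockP a a' e e' (y, A)) := by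
    intro hy
    rw [blockP, transMat_eq e e' hy]
    constructor
    · rintro ⟨A', hA'⟩
      rw [planeIn_ofGraph, map_graph_eq_graph_iff] at hA'
      exact hA'.1
    · intro h
      exact ⟨_, (planeIn_ofGraph _ _ _ _ _ _).trans
        ((map_graph_eq_graph_iff _ _ _).2 ⟨h, rfl⟩)⟩
  rw [PartialEquiv.trans_source]
  constructor
  · rintro ⟨h1, h2, h3⟩
    have hy : y ∈ ((chartAt (ModelSpace n) a).symm.trans (chartAt (ModelSpace n) a')).source := by
      rw [OpenPartialHomeomorph.trans_source]; exact ⟨h1, h2⟩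
    exact ⟨hy, (key hy).1 h3⟩
  · rintro ⟨hy, h⟩
    have h3 := (key hy).2 h
    change y ∈ _ at hy
    rw [OpenPartialHomeomorph.trans_source] at hy
    exact ⟨hy.1, hy.2, h3⟩

theorem jetChart_trans_apply {a a' : W}
    {e e' : ModelSpace n ≃L[ℝ] CoordSpace n × CoordSpace n}
    {z : ModelSpace n × (CoordSpace n →L[ℝ] CoordSpace n)}
    (hz : z ∈ ((jetChart a e).symm.trans (jetChart a' e')).source) :
    (jetChart a e).symm.trans (jetChart a' e') z =
      ((chartAt (ModelSpace n) a' ∘ (chartAt (ModelSpace n) a).symm) z.1,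
        (blockQ a a' e e' z).comp (Ring.inverse (blockP a a' e e' z))) := by
  rw [jetChart_trans_source] at hz
  obtain ⟨hy, hu⟩ := hz
  refine Prod.ext rfl (slope_eq ?_)
  change planeIn a' e' (ofGraph a e ((chartAt (ModelSpace n) a).symm z.1) z.2) = _
  rw [blockP, transMat_eq e e' hy] at hu
  rw [planeIn_ofGraph, blockP, blockQ, transMat_eq e e' hy]
  exact (map_graph_eq_graph_iff _ _ _).2 ⟨hu, rfl⟩

theorem contDiffOn_blockP (a a' : W) (e e' : ModelSpace n ≃L[ℝ] CoordSpace n × CoordSpace n) :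
    ContDiffOn ℝ ∞ (blockP a a' e e')
      {z | z.1 ∈ ((chartAt (ModelSpace n) a).symm.trans (chartAt (ModelSpace n) a')).source} := by
  have h1 : ContDiffOn ℝ ∞ (fun z : ModelSpace n × (CoordSpace n →L[ℝ] CoordSpace n) =>
      transMat a a' e e' z.1)
      {z | z.1 ∈ ((chartAt (ModelSpace n) a).symm.trans (chartAt (ModelSpace n) a')).source} :=
    (contDiffOn_transMat a a' e e').comp contDiffOn_fst (fun z hz => hz)
  have h2 : ContDiff ℝ ∞ (fun z : ModelSpace n × (CoordSpace n →L[ℝ] CoordSpace n) =>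
      (ContinuousLinearMap.id ℝ (CoordSpace n)).prod z.2) :=
    (ContinuousLinearMap.prodₗᵢ (𝕜 := ℝ) (E := CoordSpace n) (F := CoordSpace n)
      (G := CoordSpace n) ℝ).contDiff.comp (contDiff_const.prodMk contDiff_snd)
  exact contDiffOn_const.clm_comp (h1.clm_comp h2.contDiffOn)

theorem contDiffOn_blockQ (a a' : W) (e e' : ModelSpace n ≃L[ℝ] CoordSpace n × CoordSpace n) :
    ContDiffOn ℝ ∞ (blockQ a a' e e')
      {z | z.1 ∈ ((chartAt (ModelSpace n) a).symm.trans (chartAt (ModelSpace n) a')).source} := by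
  have h1 : ContDiffOn ℝ ∞ (fun z : ModelSpace n × (CoordSpace n →L[ℝ] CoordSpace n) =>
      transMat a a' e e' z.1)
      {z | z.1 ∈ ((chartAt (ModelSpace n) a).symm.trans (chartAt (ModelSpace n) a')).source} :=
    (contDiffOn_transMat a a' e e').comp contDiffOn_fst (fun z hz => hz)
  have h2 : ContDiff ℝ ∞ (fun z : ModelSpace n × (CoordSpace n →L[ℝ] CoordSpace n) =>
      (ContinuousLinearMap.id ℝ (CoordSpace n)).prod z.2) :=
    (ContinuousLinearMap.prodₗᵢ (𝕜 := ℝ) (E := CoordSpace n) (F := CoordSpace n)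
      (G := CoordSpace n) ℝ).contDiff.comp (contDiff_const.prodMk contDiff_snd)
  exact contDiffOn_const.clm_comp (h1.clm_comp h2.contDiffOn)

theorem isOpen_jetChart_trans_source (a a' : W)
    (e e' : ModelSpace n ≃L[ℝ] CoordSpace n × CoordSpace n) :
    IsOpen ((jetChart a e).symm.trans (jetChart a' e')).source := by
  rw [jetChart_trans_source]
  exact (contDiffOn_blockP a a' e e').continuousOn.isOpen_inter_preimage
    (((chartAt (ModelSpace n) a).symm.trans (chartAt (ModelSpace n) a')).open_source.preimage
      continuous_fst) Units.isOpen

theorem contDiffOn_jetChart_trans (a a' : W)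
    (e e' : ModelSpace n ≃L[ℝ] CoordSpace n × CoordSpace n) :
    ContDiffOn ℝ ∞ ((jetChart a e).symm.trans (jetChart a' e'))
      ((jetChart a e).symm.trans (jetChart a' e')).source := by
  refine ContDiffOn.congr (f := fun z =>
      ((chartAt (ModelSpace n) a' ∘ (chartAt (ModelSpace n) a).symm) z.1,
        (blockQ a a' e e' z).comp (Ring.inverse (blockP a a' e e' z)))) ?_
    (fun z hz => jetChart_trans_apply hz)
  rw [jetChart_trans_source]
  have hsub : {z : ModelSpace n × (CoordSpace n →L[ℝ] CoordSpace n) |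
      z.1 ∈ ((chartAt (ModelSpace n) a).symm.trans (chartAt (ModelSpace n) a')).source ∧
        IsUnit (blockP a a' e e' z)} ⊆
      {z | z.1 ∈ ((chartAt (ModelSpace n) a).symm.trans (chartAt (ModelSpace n) a')).source} :=
    fun z hz => hz.1
  refine ContDiffOn.prodMk ((contDiffOn_chart_trans a a').comp contDiffOn_fst fun z hz => hz.1) ?_
  refine ((contDiffOn_blockQ a a' e e').mono hsub).clm_comp ?_
  intro z hz
  obtain ⟨u, hu⟩ := hz.2
  have h := contDiffAt_ringInverse ℝ (n := ∞) u
  rw [hu] at h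
  exact h.comp_contDiffWithinAt z ((contDiffOn_blockP a a' e e').mono hsub z hz)

theorem exists_mem_jetChart_source (q : JetOne n W) :
    ∃ e : ModelSpace n ≃L[ℝ] CoordSpace n × CoordSpace n, q ∈ (jetChart q.pt e).source := by
  obtain ⟨e, he⟩ := exists_split
    (q.plane.map ((chartDeriv q.pt q.pt).toLinearEquiv.toLinearMap :
      TangentSpace (𝓡 (2 * n)) q.pt →ₗ[ℝ] ModelSpace n))
    (by rw [LinearEquiv.finrank_map_eq]; exact q.finrank_plane)
  refine ⟨e, mem_chart_source _ _, 0, ?_⟩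
  rw [← he, ← Submodule.map_comp]
  rfl

/-- The smooth atlas of `J¹ₙ(W)`. -/
def chartedSpaceCore :
    ChartedSpaceCore (ModelSpace n × (CoordSpace n →L[ℝ] CoordSpace n)) (JetOne n W) where
  atlas := {c | ∃ a e, c = jetChart a e}
  chartAt q := jetChart q.pt (exists_mem_jetChart_source q).choose
  mem_chart_source q := (exists_mem_jetChart_source q).choose_spec
  chart_mem_atlas q := ⟨_, _, rfl⟩
  open_source := by
    rintro _ _ ⟨a, e, rfl⟩ ⟨a', e', rfl⟩
    exact isOpen_jetChart_trans_source a a' e e'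
  continuousOn_toFun := by
    rintro _ _ ⟨a, e, rfl⟩ ⟨a', e', rfl⟩
    exact (contDiffOn_jetChart_trans a a' e e').continuousOn

instance : TopologicalSpace (JetOne n W) := chartedSpaceCore.toTopologicalSpace

instance : ChartedSpace (ModelSpace n × (CoordSpace n →L[ℝ] CoordSpace n)) (JetOne n W) :=
  chartedSpaceCore.toChartedSpace

/-- The model of `J¹ₙ(W)`. -/
abbrev model (n : ℕ) : ModelWithCorners ℝ (ModelSpace n × (CoordSpace n →L[ℝ] CoordSpace n))
    (ModelSpace n × (CoordSpace n →L[ℝ] CoordSpace n)) :=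
  𝓘(ℝ, ModelSpace n × (CoordSpace n →L[ℝ] CoordSpace n))

instance : IsManifold (model n) ∞ (JetOne n W) := by
  refine isManifold_of_contDiffOn _ _ _ ?_
  rintro c c' hc hc'
  obtain ⟨_, ⟨_, rfl⟩, hc⟩ := hc
  obtain ⟨_, ⟨⟨a, e, rfl⟩, rfl⟩, rfl⟩ := hc
  obtain ⟨_, ⟨_, rfl⟩, hc'⟩ := hc'
  obtain ⟨_, ⟨⟨a', e', rfl⟩, rfl⟩, rfl⟩ := hc'
  have := contDiffOn_jetChart_trans a a' e e'
  simpa using! this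

/-- The projection `J¹ₙ(W) → W` is smooth. -/
theorem contMDiff_pt : ContMDiff (model n) (𝓡 (2 * n)) ∞ (JetOne.pt : JetOne n W → W) := by
  intro q
  have hq := mem_chart_source (ModelSpace n × (CoordSpace n →L[ℝ] CoordSpace n)) q
  have h1 : ContMDiffAt (model n) (model n) ∞
      (chartAt (ModelSpace n × (CoordSpace n →L[ℝ] CoordSpace n)) q) q :=
    contMDiffAt_of_mem_maximalAtlas (IsManifold.chart_mem_maximalAtlas q) hq
  have h2 : ContMDiffAt (model n) (𝓡 (2 * n)) ∞
      (fun z : ModelSpace n × (CoordSpace n →L[ℝ] CoordSpace n) => z.1)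
      (chartAt (ModelSpace n × (CoordSpace n →L[ℝ] CoordSpace n)) q q) :=
    contDiff_fst.contMDiff.contMDiffAt
  have h3 : ContMDiffAt (𝓡 (2 * n)) (𝓡 (2 * n)) ∞ (chartAt (ModelSpace n) q.pt).symm
      (chartAt (ModelSpace n × (CoordSpace n →L[ℝ] CoordSpace n)) q q).1 :=
    contMDiffAt_symm_of_mem_maximalAtlas (IsManifold.chart_mem_maximalAtlas q.pt)
      (mem_chart_target (ModelSpace n) q.pt)
  refine (h3.comp q (h2.comp q h1)).congr_of_eventuallyEq ?_
  filter_upwards [(chartAt (ModelSpace n × (CoordSpace n →L[ℝ] CoordSpace n))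
    q).open_source.mem_nhds hq] with q' hq'
  exact ((chartAt (ModelSpace n) q.pt).left_inv hq'.1).symm

/-- The Cartan distribution of `J¹ₙ(W)`: at a jet `q`, it consists of the tangent vectors of
`J¹ₙ(W)` that project to the plane of `q`. -/
def cartan (q : JetOne n W) : Submodule ℝ (TangentSpace (model n) q) :=
  q.plane.comap (mfderiv (model n) (𝓡 (2 * n)) JetOne.pt q :
    TangentSpace (model n) q →ₗ[ℝ] TangentSpace (𝓡 (2 * n)) q.pt)

end JetOne

section Symplectic

variable {n : ℕ} {W : Type*} [TopologicalSpace W] [ChartedSpace (ModelSpace n) W]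

/-- The coordinate expression, in the chart around `a`, of a field of alternating bilinear forms on
the tangent spaces of `W`: its pullback by the inverse of the chart. -/
def formInChart (η : ∀ x : W, TangentSpace (𝓡 (2 * n)) x [⋀^Fin 2]→L[ℝ] ℝ) (a : W)
    (y : ModelSpace n) : ModelSpace n [⋀^Fin 2]→L[ℝ] ℝ :=
  (η ((chartAt (ModelSpace n) a).symm y)).compContinuousLinearMap
    (mfderiv (𝓡 (2 * n)) (𝓡 (2 * n)) (chartAt (ModelSpace n) a).symm y)

variable (n W) in
/-- A symplectic form on the `2n`-dimensional manifold `W`: a smooth, closed, non-degenerate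
differential `2`-form. -/
structure SymplecticForm where
  form : ∀ x : W, TangentSpace (𝓡 (2 * n)) x [⋀^Fin 2]→L[ℝ] ℝ
  smooth : ∀ a : W, ContDiffOn ℝ ∞ (formInChart form a) (chartAt (ModelSpace n) a).target
  closed : ∀ a : W, ∀ y ∈ (chartAt (ModelSpace n) a).target, extDeriv (formInChart form a) y = 0
  nondegenerate : ∀ (x : W) (u : TangentSpace (𝓡 (2 * n)) x),
    (∀ v : TangentSpace (𝓡 (2 * n)) x, form x ![u, v] = 0) → u = 0

/-- The first order partial differential equation `𝓛₁ ⊆ J¹ₙ(W)` of Lagrangian submanifolds: the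
jets whose plane is Lagrangian, that is, `n`-dimensional with vanishing restriction of `σ`. -/
def lagrangianPDE (σ : SymplecticForm n W) : Set (JetOne n W) :=
  {q | ∀ u ∈ q.plane, ∀ v ∈ q.plane, σ.form q.pt ![u, v] = 0}

end Symplectic

section BarChains

universe u v w

variable {n : ℕ} {W : Type u} [TopologicalSpace W] [ChartedSpace (ModelSpace n) W]
  [IsManifold (𝓡 (2 * n)) ∞ W]

/-- A bar singular `p`-simplex of a first order equation `𝓔 ⊆ J¹ₙ(W)` is a map from the standard
simplex `Δᵖ ⊆ ℝᵖ⁺¹` to `𝓔` that extends to a smooth map from an open neighbourhood of `Δᵖ` in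
`ℝᵖ⁺¹` to `𝓔` and whose tangent map sends the vectors tangent to `Δᵖ` (those with coordinate
sum `0`) into the Cartan distribution. -/
def IsBarSimplex (𝓔 : Set (JetOne n W)) (p : ℕ)
    (f : stdSimplex ℝ (Fin (p + 1)) → JetOne n W) : Prop :=
  ∃ (U : Set (Fin (p + 1) → ℝ)) (g : (Fin (p + 1) → ℝ) → JetOne n W),
    IsOpen U ∧ stdSimplex ℝ (Fin (p + 1)) ⊆ U ∧
    ContMDiffOn 𝓘(ℝ, Fin (p + 1) → ℝ) (JetOne.model n) ∞ g U ∧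
    MapsTo g U 𝓔 ∧
    (∀ x : stdSimplex ℝ (Fin (p + 1)), g x = f x) ∧
    ∀ x ∈ stdSimplex ℝ (Fin (p + 1)), ∀ t : Fin (p + 1) → ℝ, ∑ i, t i = 0 →
      mfderiv 𝓘(ℝ, Fin (p + 1) → ℝ) (JetOne.model n) g x t ∈ JetOne.cartan (g x)

/-- The set of bar singular `p`-simplices of `𝓔`. -/
def BarSimplex (𝓔 : Set (JetOne n W)) (p : ℕ) : Type u :=
  {f : stdSimplex ℝ (Fin (p + 1)) → JetOne n W // IsBarSimplex 𝓔 p f}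

theorem IsBarSimplex.comp_map {𝓔 : Set (JetOne n W)} {p k : ℕ}
    {f : stdSimplex ℝ (Fin (p + 1)) → JetOne n W} (hf : IsBarSimplex 𝓔 p f)
    (φ : Fin (k + 1) → Fin (p + 1)) : IsBarSimplex 𝓔 k (f ∘ stdSimplex.map φ) := by
  obtain ⟨U, g, hU, hΔ, hg, hE, hgf, hT⟩ := hf
  let θ : (Fin (k + 1) → ℝ) →L[ℝ] (Fin (p + 1) → ℝ) :=
    LinearMap.toContinuousLinearMap (FunOnFinite.linearMap ℝ ℝ φ)
  have hθ : ∀ x : stdSimplex ℝ (Fin (k + 1)), θ x = stdSimplex.map φ x := fun x => rfl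
  have hθΔ : ∀ x ∈ stdSimplex ℝ (Fin (k + 1)), θ x ∈ stdSimplex ℝ (Fin (p + 1)) :=
    fun x hx => (stdSimplex.map φ ⟨x, hx⟩).2
  refine ⟨θ ⁻¹' U, g ∘ θ, hU.preimage θ.continuous, fun x hx => hΔ (hθΔ x hx),
    hg.comp θ.contMDiff.contMDiffOn (fun x hx => hx), fun x hx => hE hx,
    fun x => ?_, fun x hx t ht => ?_⟩
  · exact hgf (stdSimplex.map φ x)
  · have hgx : MDifferentiableAt 𝓘(ℝ, Fin (p + 1) → ℝ) (JetOne.model n) g (θ x) :=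
      (hg.contMDiffAt (hU.mem_nhds (hΔ (hθΔ x hx)))).mdifferentiableAt (by simp)
    have hθt : ∑ i, θ t i = 0 := by
      rw [← ht]
      simp only [θ, LinearMap.coe_toContinuousLinearMap', FunOnFinite.linearMap_apply_apply]
      exact Finset.sum_fiberwise _ _ _
    have hmd : MDifferentiableAt 𝓘(ℝ, Fin (k + 1) → ℝ) 𝓘(ℝ, Fin (p + 1) → ℝ) θ x :=
      θ.mdifferentiableAt
    have hc := mfderiv_comp x hgx hmd
    rw [hc, θ.mfderiv_eq]
    exact hT (θ x) (hθΔ x hx) (θ t) hθt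

/-- Pullback of bar simplices along the affine map of simplices induced by a map of vertices. -/
def BarSimplex.pullback {𝓔 : Set (JetOne n W)} {p k : ℕ} (φ : Fin (k + 1) → Fin (p + 1))
    (f : BarSimplex 𝓔 p) : BarSimplex 𝓔 k :=
  ⟨f.1 ∘ stdSimplex.map φ, f.2.comp_map φ⟩

open CategoryTheory

variable (R : Type w) [Ring R] (G : Type v) [AddCommGroup G] [Module R G]
  (𝓔 : Set (JetOne n W))

/-- The simplicial module of bar chains: in degree `p` the formal finite linear combinations
of bar singular `p`-simplices of `𝓔` with coefficients in `G`. -/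
def barSimplicialModule : SimplicialObject (ModuleCat.{max u v} R) where
  obj m := ModuleCat.of R (BarSimplex 𝓔 m.unop.len →₀ G)
  map φ := ModuleCat.ofHom (Finsupp.lmapDomain G R (BarSimplex.pullback φ.unop.toOrderHom))
  map_id m := by
    ext : 1
    refine Eq.trans ?_ (Finsupp.lmapDomain_id G R)
    refine congrArg (Finsupp.lmapDomain G R) (funext fun f => Subtype.ext (funext fun x => ?_))
    exact congrArg f.1 (by simp)
  map_comp φ ψ := by
    ext : 1
    refine Eq.trans ?_ (Finsupp.lmapDomain_comp G R _ _)
    refine congrArg (Finsupp.lmapDomain G R) (funext fun f => Subtype.ext (funext fun x => ?_))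
    exact congrArg f.1 (by simp [stdSimplex.map_comp_apply])

/-- The bar singular chain complex of `𝓔` with coefficients in `G`; its differential is the
alternating sum of the faces. -/
def barComplex : ChainComplex (ModuleCat.{max u v} R) ℕ :=
  (AlgebraicTopology.alternatingFaceMapComplex (ModuleCat.{max u v} R)).obj
    (barSimplicialModule R G 𝓔)

/-- The module `C̄_p(𝓔; G)` of bar singular `p`-chains. -/
abbrev BarChain (p : ℕ) : Type (max u v) := (barComplex R G 𝓔).X p

/-- The boundaries `B̄_p(𝓔; G)`. -/
def barBoundaries (p : ℕ) : Submodule R (BarChain R G 𝓔 p) :=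
  LinearMap.range ((barComplex R G 𝓔).d (p + 1) p).hom

/-- The cycles `Z̄_p(𝓔; G)`. In degree `0` the differential is zero and every chain is a cycle. -/
def barCycles (p : ℕ) : Submodule R (BarChain R G 𝓔 p) :=
  LinearMap.ker ((barComplex R G 𝓔).d p (p - 1)).hom

/-- The bar singular homology `H̄_p(𝓔; G)`. -/
abbrev BarHomology (p : ℕ) : Type (max u v) := (barComplex R G 𝓔).homology p

/-- The bordism group: chains `a`, `b` are identified when `a - b = ∂̄ c` for some chain `c`. -/
abbrev BarBor (p : ℕ) : Type (max u v) := BarChain R G 𝓔 p ⧸ barBoundaries R G 𝓔 p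

/-- The cyclism group: chains `a`, `b` are identified when `∂̄ (a - b) = 0`. -/
abbrev BarCyc (p : ℕ) : Type (max u v) := BarChain R G 𝓔 p ⧸ barCycles R G 𝓔 p

/-- The closed `G`-singular bordism group: cycles `a`, `b` are identified when `a - b = ∂̄ c` for
some chain `c`. -/
abbrev ClosedBordism (p : ℕ) : Type (max u v) :=
  barCycles R G 𝓔 p ⧸ (barBoundaries R G 𝓔 p).submoduleOf (barCycles R G 𝓔 p)

/-- The bordism class of a chain. -/
abbrev borClass {p : ℕ} (c : BarChain R G 𝓔 p) : BarBor R G 𝓔 p :=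
  Submodule.Quotient.mk c

/-- The cyclism class of a chain. -/
abbrev cycClass {p : ℕ} (c : BarChain R G 𝓔 p) : BarCyc R G 𝓔 p :=
  Submodule.Quotient.mk c

/-- The closed bordism class of a cycle. -/
abbrev closedBordismClass {p : ℕ} (z : barCycles R G 𝓔 p) : ClosedBordism R G 𝓔 p :=
  Submodule.Quotient.mk z

end BarChains

end

/-! Once the bar complex is built, the statement is homological algebra. Write `B ≤ Z ≤ M` for
boundaries, cycles and chains in degree `p`; the first inclusion is `∂̄ ∘ ∂̄ = 0`. Everything rests
on the short exact sequence `0 → Z/B → M/B → M/Z → 0`, whose left term is the closed bordism group.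

If the left term vanishes, then `B = Z` and the other two terms coincide. If `M/Z` is free, it is
projective, so the surjection onto it has a section and the sequence splits; these two cases are
`exists_quotientEquiv_of_subsingleton` and `exists_quotientEquivProd_of_projective`.

The homology statement compares the concrete quotient `Z/B` with the categorical homology object.
The abstract cycles embed in the chains with image `Z`, and the kernel of the projection to homology
corresponds to `B` under this embedding (`range_iCycles`, `ker_homologyπ`). -/

namespace Submodule

/-! ### The exact sequence of nested quotients and its splitting. -/

variable {R : Type*} [Ring R] {M : Type*} [AddCommGroup M] [Module R M]

/-- The map `Z / B → M / B` induced by the inclusion of `Z` in `M`. -/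
def quotientSubmoduleOfMap (B Z : Submodule R M) : (Z ⧸ B.submoduleOf Z) →ₗ[R] M ⧸ B :=
  (B.submoduleOf Z).mapQ B Z.subtype le_rfl

theorem quotientSubmoduleOfMap_injective (B Z : Submodule R M) :
    Function.Injective (quotientSubmoduleOfMap B Z) := by
  rw [injective_iff_map_eq_zero]
  intro x hx
  obtain ⟨z, rfl⟩ := mkQ_surjective _ x
  have hz : (z : M) ∈ B := (Quotient.mk_eq_zero B).1 hx
  exact (Quotient.mk_eq_zero _).2 hz

/-- The class of `c` modulo `B` dies modulo `Z` exactly when `c ∈ Z`. Since `B ≤ Z`, membership in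
`Z` does not depend on the representative modulo `B`, so this is the same as being the class of an
element of `Z`. -/
theorem exact_quotientSubmoduleOfMap_factor {B Z : Submodule R M} (h : B ≤ Z) :
    Function.Exact (quotientSubmoduleOfMap B Z) (factor h) := by
  intro x
  obtain ⟨c, rfl⟩ := mkQ_surjective B x
  rw [factor_mk, mkQ_apply, Quotient.mk_eq_zero]
  constructor
  · intro hc
    exact ⟨Quotient.mk ⟨c, hc⟩, rfl⟩
  · rintro ⟨y, hy⟩
    obtain ⟨z, rfl⟩ := mkQ_surjective _ y
    have hz : (z : M) - c ∈ B := (Submodule.Quotient.eq B).1 hy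
    have := Z.sub_mem z.2 (h hz)
    rwa [sub_sub_cancel] at this

theorem exists_quotientEquiv_of_subsingleton {B Z : Submodule R M} (h : B ≤ Z)
    (hs : Subsingleton (Z ⧸ B.submoduleOf Z)) :
    ∃ e : (M ⧸ B) ≃ₗ[R] M ⧸ Z, ∀ c : M, e (Quotient.mk c) = Quotient.mk c := by
  -- In a trivial quotient every class is zero, which for the class of `c ∈ Z` means `c ∈ B`.
  have hZ : Z ≤ B := fun c hc =>
    (Quotient.mk_eq_zero (B.submoduleOf Z)).1 (Subsingleton.elim (Quotient.mk ⟨c, hc⟩) 0)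
  exact ⟨quotEquivOfEq B Z (le_antisymm h hZ), fun _ => rfl⟩

/-- Projectivity lifts the identity of `M ⧸ Z` through `factor h`, and a section of the surjection
splits the sequence. The two clauses record compatibility with the inclusion and the projection; the
first component of `e` on a general class depends on the chosen section. -/
theorem exists_quotientEquivProd_of_projective {B Z : Submodule R M} (h : B ≤ Z)
    [Module.Projective R (M ⧸ Z)] :
    ∃ e : (M ⧸ B) ≃ₗ[R] (Z ⧸ B.submoduleOf Z) × M ⧸ Z,
      (∀ z : Z, e (Quotient.mk (z : M)) = (Quotient.mk z, 0)) ∧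
        ∀ c : M, (e (Quotient.mk c)).2 = Quotient.mk c := by
  obtain ⟨s, hs⟩ := Module.projective_lifting_property (factor h) LinearMap.id (factor_surjective h)
  obtain ⟨e, he, he'⟩ := (exact_quotientSubmoduleOfMap_factor h).splitSurjectiveEquiv
    (quotientSubmoduleOfMap_injective B Z) ⟨s, hs⟩
  refine ⟨e, fun z => ?_, fun c => (LinearMap.congr_fun he' (Quotient.mk c)).symm⟩
  -- The splitting describes the inclusion through `e.symm`, as `e.symm` composed with the first
  -- injection, so `e` is moved to the other side.
  rw [← LinearEquiv.eq_symm_apply]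
  exact LinearMap.congr_fun he (Quotient.mk z)

end Submodule

/-! ### Categorical homology as cycles modulo boundaries. -/

namespace ChainComplex

open CategoryTheory

universe v w

variable {R : Type w} [Ring R] (K : ChainComplex (ModuleCat.{v} R) ℕ) (p : ℕ)

theorem range_d_le_ker_d :
    LinearMap.range (K.d (p + 1) p).hom ≤ LinearMap.ker (K.d p (p - 1)).hom := by
  rintro _ ⟨c, rfl⟩
  exact congrArg (fun f => f.hom c) (K.d_comp_d (p + 1) p (p - 1))

/-- For `p = 0` truncated subtraction gives `0`, which agrees with the default value of `next` at an
index without successor. As `0` is not related to itself in the complex shape, `K.d 0 0` is zero and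
its kernel is all of `K.X 0`. -/
theorem next_nat : (ComplexShape.down ℕ).next p = p - 1 := by
  cases p <;> simp

theorem iCycles_injective : Function.Injective (K.iCycles p).hom :=
  (ModuleCat.mono_iff_injective _).1 inferInstance

theorem homologyπ_surjective : Function.Surjective (K.homologyπ p).hom :=
  (ModuleCat.epi_iff_surjective _).1 inferInstance

theorem range_iCycles :
    LinearMap.range (K.iCycles p).hom = LinearMap.ker (K.d p (p - 1)).hom := by
  ext x
  constructor
  · rintro ⟨w, rfl⟩
    exact congrArg (fun f => f.hom w) (K.iCycles_d p (p - 1))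
  · intro hx
    exact ⟨K.cyclesMk x (p - 1) (next_nat p) hx, K.i_cyclesMk x (p - 1) (next_nat p) hx⟩

/-- Homology is the cokernel of `toCycles`, so the kernel of the projection is the image of
`toCycles`. Composing `toCycles` with the injection `iCycles` gives the differential, which turns
that image into the preimage of the boundaries. -/
theorem ker_homologyπ :
    LinearMap.ker (K.homologyπ p).hom =
      (LinearMap.range (K.d (p + 1) p).hom).comap (K.iCycles p).hom := by
  have hex : (ShortComplex.mk _ _ (K.toCycles_comp_homologyπ (p + 1) p)).Exact :=
    ShortComplex.exact_of_g_is_cokernel _ (K.homologyIsCokernel (p + 1) p (by simp))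
  rw [ShortComplex.moduleCat_exact_iff_ker_sub_range] at hex
  have hi : ∀ c, (K.iCycles p).hom ((K.toCycles (p + 1) p).hom c) = (K.d (p + 1) p).hom c :=
    fun c => congrArg (fun f => f.hom c) (K.toCycles_i (p + 1) p)
  ext w
  constructor
  · intro hw
    obtain ⟨c, rfl⟩ := hex hw
    exact ⟨c, (hi c).symm⟩
  · rintro ⟨c, hc⟩
    -- Both sides have the same image in the chains, and `iCycles` is injective.
    obtain rfl : (K.toCycles (p + 1) p).hom c = w := K.iCycles_injective p ((hi c).trans hc)
    exact congrArg (fun f => f.hom c) (K.toCycles_comp_homologyπ (p + 1) p)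

/-- The homology of a chain complex of modules is the quotient of the kernel of the differential by
the range of the differential. -/
theorem exists_kerQuotientRangeEquiv_homology :
    ∃ e : (LinearMap.ker (K.d p (p - 1)).hom ⧸ (LinearMap.range (K.d (p + 1) p).hom).submoduleOf
          (LinearMap.ker (K.d p (p - 1)).hom)) ≃ₗ[R] K.homology p,
      ∀ (z : LinearMap.ker (K.d p (p - 1)).hom) (w : K.cycles p), K.iCycles p w = (z : K.X p) →
        e (Submodule.Quotient.mk z) = K.homologyπ p w := by
  -- Corestricting `iCycles` to its image identifies the abstract cycles with the kernel of the
  -- differential.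
  let ι : K.cycles p ≃ₗ[R] LinearMap.ker (K.d p (p - 1)).hom :=
    (LinearEquiv.ofInjective _ (K.iCycles_injective p)).trans
      (LinearEquiv.ofEq _ _ (K.range_iCycles p))
  -- Under `ι`, the kernel of the projection to homology becomes the boundaries, so `ι` descends to
  -- the quotients.
  have hι : (LinearMap.ker (K.homologyπ p).hom).map (ι : K.cycles p →ₗ[R] _) =
      (LinearMap.range (K.d (p + 1) p).hom).submoduleOf (LinearMap.ker (K.d p (p - 1)).hom) := by
    rw [ker_homologyπ, Submodule.map_equiv_eq_comap_symm]
    ext z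
    obtain ⟨w, rfl⟩ := ι.surjective z
    simp only [Submodule.mem_comap, LinearEquiv.coe_coe, LinearEquiv.symm_apply_apply]
    rfl
  refine ⟨(Submodule.Quotient.equiv _ _ ι hι).symm.trans
    ((K.homologyπ p).hom.quotKerEquivOfSurjective (K.homologyπ_surjective p)), fun z w h => ?_⟩
  -- The condition on `w` says exactly that `w` is the abstract cycle matching `z`; such a `w`
  -- exists and is unique, so the formula determines the isomorphism.
  obtain rfl : ι w = z := Subtype.ext h
  have : (Submodule.Quotient.equiv _ _ ι hι).symm (Submodule.Quotient.mk (ι w)) =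
      Submodule.Quotient.mk w := by
    rw [LinearEquiv.symm_apply_eq]
    rfl
  rw [LinearEquiv.trans_apply, this]
  rfl

end ChainComplex

/-! ### The Lagrangian bordism groups. -/

theorem mainTheorem3 {n : ℕ} {W : Type*} [TopologicalSpace W]
    [ChartedSpace (ModelSpace n) W] [IsManifold (𝓡 (2 * n)) ∞ W] (σ : SymplecticForm n W)
    (R : Type*) [Ring R] (G : Type*) [AddCommGroup G] [Module R G] (p : ℕ) :
    (∃ e : ClosedBordism R G (lagrangianPDE σ) p ≃ₗ[R] BarHomology R G (lagrangianPDE σ) p,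
      ∀ (z : barCycles R G (lagrangianPDE σ) p) (w : (barComplex R G (lagrangianPDE σ)).cycles p),
        (barComplex R G (lagrangianPDE σ)).iCycles p w = (z : BarChain R G (lagrangianPDE σ) p) →
        e (closedBordismClass R G (lagrangianPDE σ) z) =
          (barComplex R G (lagrangianPDE σ)).homologyπ p w) ∧
    (Subsingleton (ClosedBordism R G (lagrangianPDE σ) p) →
      ∃ e : BarBor R G (lagrangianPDE σ) p ≃ₗ[R] BarCyc R G (lagrangianPDE σ) p,
        ∀ c, e (borClass R G (lagrangianPDE σ) c) = cycClass R G (lagrangianPDE σ) c) ∧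
    (Module.Free R (BarCyc R G (lagrangianPDE σ) p) →
      ∃ e : BarBor R G (lagrangianPDE σ) p ≃ₗ[R]
          ClosedBordism R G (lagrangianPDE σ) p × BarCyc R G (lagrangianPDE σ) p,
        (∀ z : barCycles R G (lagrangianPDE σ) p,
          e (borClass R G (lagrangianPDE σ) z) =
            (closedBordismClass R G (lagrangianPDE σ) z, 0)) ∧
        ∀ c, (e (borClass R G (lagrangianPDE σ) c)).2 = cycClass R G (lagrangianPDE σ) c) := by
  have hBZ : barBoundaries R G (lagrangianPDE σ) p ≤ barCycles R G (lagrangianPDE σ) p :=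
    (barComplex R G (lagrangianPDE σ)).range_d_le_ker_d p
  exact ⟨(barComplex R G (lagrangianPDE σ)).exists_kerQuotientRangeEquiv_homology p,
    Submodule.exists_quotientEquiv_of_subsingleton hBZ,
    -- The freeness hypothesis, once introduced, supplies the `Module.Projective` instance.
    fun _ => Submodule.exists_quotientEquivProd_of_projective hBZ⟩
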